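/- Let $X$ be a spectral space, that is, a quasicompact, sober ($T_0$, and every nonempty irreducible closed subset has a generic point) topological space whose quasicompact open subsets form a basis of the topology and are closed under finite intersections. Then there are a polynomial ring $D=\mathbb{Z}[x_i : i\in I]$ over the integers, in a possibly infinite set of variables, with quotient field $F$, and a set $Y$ of subrings of $F$ such that $D\subseteq S\subseteq F$ for every $S\in Y$, every $S\in Y$ is a localization $D_P=\{a/s : a\in D,\ s\in D\setminus P\}$ of $D$ at some prime ideal $P$ of $D$, and $X$ is homeomorphic to $Y$. Here $Y$ carries the Zariski topology, that is, the subspace topology inherited from the topology on the set of all subrings of $F$ that has as a basis of open sets the sets $\{S : r_1,\ldots,r_n\in S\}$ with $n\ge 0$ and $r_1,\ldots,r_n\in F$. In particular, every spectral space is homeomorphic to a space of rings, with the Zariski topology, between some domain and its quotient field. -/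

import Mathlib

universe u

/-- The Zariski topology on the set of all subrings of a commutative ring `R`. Its basic open sets
are `U(r₁, …, rₙ) = {S | r₁, …, rₙ ∈ S}` for finite subsets `{r₁, …, rₙ}` of `R`; this family
is closed under finite intersections and contains the whole space. -/
instance Subring.zariskiTopology (R : Type*) [CommRing R] : TopologicalSpace (Subring R) :=
  TopologicalSpace.generateFrom
    {U | ∃ s : Finset R, U = {S : Subring R | ∀ r ∈ s, r ∈ S}}

/-- The localization `D_P` of a domain `D` at a prime ideal `P`, as a subring of the quotient field
of `D`: it consists of the fractions `a / s` with `a ∈ D` and `s ∈ D \ P`. -/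
noncomputable def localizationSubring {D : Type*} [CommRing D] [IsDomain D]
    (P : PrimeSpectrum D) : Subring (FractionRing D) :=
  (Localization.subalgebra.ofField (FractionRing D) P.asIdeal.primeCompl
    P.asIdeal.primeCompl_le_nonZeroDivisors).toSubring

namespace SpectralEmbedding

open MvPolynomial Topology TopologicalSpace

/-! Take one variable `x_U` for each open `U` of `X`, and let `P_x` be generated by the `x_U` with
`x ∉ U`. Since `x_U ∉ P_x` iff `x ∈ U`, basic opens of the spectrum pull back to all opens of `X`;
continuity holds because a polynomial involves only finitely many variables. As `P ↦ D_P` is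
inducing too, so is `x ↦ D_{P_x}`, and T₀ makes it injective. -/

/-- A fraction lies in `D_P` iff it can be written with a denominator outside `P`. -/
theorem mem_localizationSubring {D : Type*} [CommRing D] [IsDomain D] (P : PrimeSpectrum D)
    (r : FractionRing D) :
    r ∈ localizationSubring P ↔ ∃ a s : D, s ∉ P.asIdeal ∧
      r = algebraMap D (FractionRing D) a * (algebraMap D (FractionRing D) s)⁻¹ := by
  unfold localizationSubring
  rw [Subalgebra.mem_toSubring]
  exact exists_congr fun a => exists_congr fun s => exists_prop

theorem range_algebraMap_le_localizationSubring {D : Type*} [CommRing D] [IsDomain D]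
    (P : PrimeSpectrum D) :
    (algebraMap D (FractionRing D)).range ≤ localizationSubring P := by
  rintro _ ⟨a, rfl⟩
  exact Subalgebra.algebraMap_mem (Localization.subalgebra.ofField (FractionRing D)
    P.asIdeal.primeCompl P.asIdeal.primeCompl_le_nonZeroDivisors) a

/-- The inverse of a nonzero `d` lies in `D_P` iff `d` lies outside `P`. -/
theorem inv_mem_localizationSubring {D : Type*} [CommRing D] [IsDomain D] (P : PrimeSpectrum D)
    {d : D} (hd : d ≠ 0) :
    (algebraMap D (FractionRing D) d)⁻¹ ∈ localizationSubring P ↔ d ∉ P.asIdeal := by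
  rw [mem_localizationSubring]
  refine ⟨?_, fun h => ⟨1, d, h, by simp⟩⟩
  rintro ⟨a, s, hs, h⟩ hdP
  have hs0 : s ≠ 0 := fun h0 => hs (h0 ▸ P.asIdeal.zero_mem)
  have inj := IsFractionRing.injective D (FractionRing D)
  have hd' : algebraMap D (FractionRing D) d ≠ 0 := (map_ne_zero_iff _ inj).2 hd
  have hs' : algebraMap D (FractionRing D) s ≠ 0 := (map_ne_zero_iff _ inj).2 hs0
  have : s = a * d := by
    apply inj
    rw [map_mul]
    field_simp at h
    rw [h, mul_comm]
  exact hs (this ▸ P.asIdeal.mul_mem_left a hdP)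

theorem isOpen_setOf_mem {R : Type*} [CommRing R] (r : R) : IsOpen {S : Subring R | r ∈ S} :=
  isOpen_generateFrom_of_mem ⟨{r}, by simp⟩

/-- The map `P ↦ D_P` from the spectrum of a domain to the space of subrings is continuous. -/
theorem continuous_localizationSubring {D : Type*} [CommRing D] [IsDomain D] :
    Continuous (localizationSubring (D := D)) := by
  refine continuous_generateFrom_iff.2 ?_
  rintro _ ⟨t, rfl⟩
  have : localizationSubring ⁻¹' {S : Subring (FractionRing D) | ∀ r ∈ t, r ∈ S} =
      ⋂ r ∈ t, {P : PrimeSpectrum D | r ∈ localizationSubring P} := by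
    ext; simp
  rw [this]
  -- One representation `a / s` of `r` serves every prime avoiding `s`.
  refine isOpen_biInter_finset fun r _ => isOpen_iff_forall_mem_open.2 fun P hP => ?_
  obtain ⟨a, s, hs, h⟩ := (mem_localizationSubring P r).1 hP
  exact ⟨PrimeSpectrum.basicOpen s, fun Q hQ => (mem_localizationSubring Q r).2 ⟨a, s, hQ, h⟩,
    (PrimeSpectrum.basicOpen s).isOpen, hs⟩

/-- The map `P ↦ D_P` is inducing: `D_P` contains `1 / d` exactly if `P` is in the basic open set
of `d`. -/
theorem isInducing_localizationSubring {D : Type*} [CommRing D] [IsDomain D] :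
    IsInducing (localizationSubring (D := D)) := by
  refine ⟨le_antisymm continuous_localizationSubring.le_induced ?_⟩
  rw [PrimeSpectrum.isTopologicalBasis_basic_opens.eq_generateFrom]
  refine le_generateFrom ?_
  rintro _ ⟨d, rfl⟩
  -- Zero is separate: `0⁻¹ = 0` lies in every subring, while its basic open is empty.
  rcases eq_or_ne d 0 with rfl | hd
  · simp
  · refine isOpen_induced_iff.2 ⟨_, isOpen_setOf_mem (algebraMap D (FractionRing D) d)⁻¹, ?_⟩
    ext P
    exact inv_mem_localizationSubring P hd

variable {X : Type*} [TopologicalSpace X]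

open Classical in
/-- The endomorphism of `ℤ[xᵤ : U open in X]` that sends to zero the variables of the open sets
not containing `x`. -/
noncomputable def killHom (x : X) : MvPolynomial (Opens X) ℤ →ₐ[ℤ] MvPolynomial (Opens X) ℤ :=
  aeval fun U => if x ∈ U then MvPolynomial.X U else 0

open Classical in
theorem killHom_X (x : X) (U : Opens X) :
    killHom x (MvPolynomial.X U) = if x ∈ U then MvPolynomial.X U else 0 :=
  aeval_X _ _

/-- The prime ideal generated by the variables of the open sets not containing `x`. -/
noncomputable def pointPrime (x : X) : PrimeSpectrum (MvPolynomial (Opens X) ℤ) :=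
  ⟨RingHom.ker (killHom x), RingHom.ker_isPrime _⟩

theorem mem_pointPrime (x : X) (f : MvPolynomial (Opens X) ℤ) :
    f ∈ (pointPrime x).asIdeal ↔ killHom x f = 0 :=
  Iff.rfl

theorem X_notMem_pointPrime (x : X) (U : Opens X) :
    MvPolynomial.X U ∉ (pointPrime x).asIdeal ↔ x ∈ U := by
  classical
  rw [mem_pointPrime, killHom_X]
  split_ifs with h <;> simp [h, X_ne_zero]

/-- If `y` lies in every open set around `x` whose variable occurs in `f`, then `killHom x f` is
determined by `killHom y f`. -/
theorem killHom_killHom {x y : X} {f : MvPolynomial (Opens X) ℤ}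
    (h : ∀ U ∈ f.vars, x ∈ U → y ∈ U) : killHom x (killHom y f) = killHom x f := by
  classical
  change ((killHom x).comp (killHom y)).toRingHom f = (killHom x).toRingHom f
  refine hom_congr_vars (by ext; simp) ?_ rfl
  intro U hU _
  change killHom x (killHom y (MvPolynomial.X U)) = killHom x (MvPolynomial.X U)
  by_cases hx : x ∈ U
  · simp [killHom_X, hx, h U hU hx]
  · by_cases hy : y ∈ U <;> simp [killHom_X, hx, hy]

/-- Finitely many variables occur in `f`, so all `y` near `x` lie in every such `U` containing `x`;
then `killHom x f` factors through `killHom y f`, and `f ∈ P_y` would force `f ∈ P_x`. -/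
theorem isOpen_setOf_notMem_pointPrime (f : MvPolynomial (Opens X) ℤ) :
    IsOpen {x : X | f ∉ (pointPrime x).asIdeal} := by
  refine isOpen_iff_mem_nhds.2 fun x hx => ?_
  have h : ∀ᶠ y in 𝓝 x, ∀ U ∈ f.vars, x ∈ U → y ∈ U :=
    (Filter.eventually_all_finset f.vars).2 fun U _ =>
      Filter.eventually_imp_distrib_left.2 fun hxU => U.isOpen.mem_nhds hxU
  filter_upwards [h] with y hxy hy
  refine hx ((mem_pointPrime x f).2 ?_)
  rw [← killHom_killHom hxy, (mem_pointPrime y f).1 hy, map_zero]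

theorem continuous_pointPrime :
    Continuous (pointPrime : X → PrimeSpectrum (MvPolynomial (Opens X) ℤ)) := by
  refine PrimeSpectrum.isTopologicalBasis_basic_opens.continuous_iff.2 ?_
  rintro _ ⟨f, rfl⟩
  exact isOpen_setOf_notMem_pointPrime f

theorem isInducing_pointPrime : IsInducing (pointPrime : X → PrimeSpectrum (MvPolynomial (Opens X) ℤ)) := by
  refine ⟨le_antisymm continuous_pointPrime.le_induced fun U hU => ?_⟩
  refine isOpen_induced_iff.2
    ⟨_, (PrimeSpectrum.basicOpen (MvPolynomial.X (R := ℤ) (⟨U, hU⟩ : Opens X))).isOpen, ?_⟩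
  ext x
  exact X_notMem_pointPrime x ⟨U, hU⟩

/-- A `T₀` space embeds into the space of localizations of a polynomial ring over `ℤ`. -/
theorem isEmbedding_localizationSubring_pointPrime [T0Space X] :
    IsEmbedding fun x : X => localizationSubring (pointPrime x) :=
  (isInducing_localizationSubring.comp isInducing_pointPrime).isEmbedding

end SpectralEmbedding

theorem mainTheorem10 (X : Type u) [TopologicalSpace X] [SpectralSpace X] :
    ∃ (σ : Type u) (Y : Set (Subring (FractionRing (MvPolynomial σ ℤ)))),
      (∀ S ∈ Y,
        (algebraMap (MvPolynomial σ ℤ) (FractionRing (MvPolynomial σ ℤ))).range ≤ S) ∧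
      (∀ S ∈ Y, ∃ P : PrimeSpectrum (MvPolynomial σ ℤ), S = localizationSubring P) ∧
      Nonempty (X ≃ₜ Y) := by
  refine ⟨TopologicalSpace.Opens X,
    Set.range fun x : X => localizationSubring (SpectralEmbedding.pointPrime x), ?_, ?_,
    ⟨SpectralEmbedding.isEmbedding_localizationSubring_pointPrime.toHomeomorph⟩⟩
  · rintro _ ⟨x, rfl⟩
    exact SpectralEmbedding.range_algebraMap_le_localizationSubring _
  · rintro _ ⟨x, rfl⟩
    exact ⟨_, rfl⟩
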